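/- Let $X$ be a proper geodesic metric space and let $G$ be a group acting on $X$ by isometries and properly (for all $x\in X$ and $r\ge 0$ only finitely many $g\in G$ satisfy $d(x,gx)\le r$). Assume that $G$ is non-elementary, i.e. neither finite nor virtually cyclic, and that $G$ contains a contracting element. Here: - Paths are parametrized by arc length, and a path is a $\lambda$-quasi-geodesic ($\lambda\ge 1$) if each of its subpaths with endpoints $x,y$ has length at most $\lambda d(x,y)+\lambda$. - A subset $A\subseteq X$ is $C$-contracting if for every geodesic $\gamma$ with $d(\gamma,A)\ge C$ the shortest point projection of $\gamma$ to $A$ has diameter at most $C$. An element $g\in G$ is contracting if for some $o\in X$ and some geodesic $[o,go]$ with $go\neq o$ the bi-infinite concatenated path $\bigcup_{n\in\mathbb Z}g^n[o,go]$ is a $C$-contracting $\lambda$-quasi-geodesic for some $C>0$ and some $\lambda\ge 1$. - A subgroup $H\le G$ is Morse if for some $o\in X$ there is a function $\eta:\mathbb R_{\ge 0}\to\mathbb R_{\ge 0}$ such that for every $\lambda\ge1$ each $\lambda$-quasi-geodesic with both endpoints in $Ho$ is contained in the closed $\eta(\lambda)$-neighbourhood of $Ho$. Fix any basepoint $o\in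 X$. Identify $y\in X$ with the function $b_y(x)=d(x,y)-d(o,y)$ in the space $C(X,\mathbb{R})$ of continuous real-valued functions on $X$ with the compact-open topology; the horofunction boundary $\partial X$ is the complement of $X$ in its closure. Two points of $\partial X$ are equivalent if their difference is a bounded function on $X$, and $[\Lambda]$ denotes the union of the equivalence classes in $\partial X$ of the points of $\Lambda\subseteq\partial X$. For a subgroup $H\le G$ let $\Lambda Ho\subseteq\partial X$ be the set of accumulation points of the orbit $Ho$; the limit set of $H$ is $[\Lambda Ho]$. Let $H\le G$ be a Morse subgroup of infinite index. Then $[\Lambda Ho]\subsetneq[\Lambda Go]$, i.e. $H$ is of second type. -/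

import Mathlib

open Set Filter Topology
open scoped NNReal

namespace CoarseGeom

section Paths

variable {X : Type*} [MetricSpace X]

/-- `γ` restricted to `I` is a geodesic: an isometric embedding of `I`. -/
def IsGeodesicOn (γ : ℝ → X) (I : Set ℝ) : Prop :=
  ∀ s ∈ I, ∀ t ∈ I, dist (γ s) (γ t) = |s - t|

/-- Any two points are the endpoints of a geodesic. -/
def IsGeodesicSpace (X : Type*) [MetricSpace X] : Prop :=
  ∀ x y : X, ∃ γ : ℝ → X, γ 0 = x ∧ γ (dist x y) = y ∧ IsGeodesicOn γ (Icc 0 (dist x y))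

/-- `γ`, parametrized by arc length on the interval `I`, is a `lam`-quasi-geodesic: every subpath
has length at most `lam * d + lam`, where `d` is the distance between its endpoints. The length of
a subpath is its total variation. -/
def IsQuasiGeodesicOn (lam : ℝ≥0) (γ : ℝ → X) (I : Set ℝ) : Prop :=
  HasUnitSpeedOn γ I ∧
    ∀ s ∈ I, ∀ t ∈ I, s ≤ t →
      eVariationOn γ (Icc s t) ≤ ENNReal.ofReal (lam * dist (γ s) (γ t) + lam)

/-- The shortest point projection of the point `x` to `A` (a set of points of `A`). -/
def proj (A : Set X) (x : X) : Set X :=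
  {a | a ∈ A ∧ ∀ b ∈ A, dist x a ≤ dist x b}

/-- `A` is `C`-contracting: every geodesic `γ` (over a bounded or unbounded interval) with
`d(γ, A) ≥ C` has projection to `A` of diameter at most `C`. -/
def IsContracting (C : ℝ) (A : Set X) : Prop :=
  ∀ (γ : ℝ → X) (I : Set ℝ), I.OrdConnected → IsGeodesicOn γ I →
    (∀ t ∈ I, ∀ a ∈ A, C ≤ dist (γ t) a) →
    ∀ s ∈ I, ∀ t ∈ I, ∀ p ∈ proj A (γ s), ∀ q ∈ proj A (γ t), dist p q ≤ C

/-- `A` is `η`-Morse: for every `lam ≥ 1`, each `lam`-quasi-geodesic with both endpoints in `A`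
is contained in the closed `η lam`-neighbourhood of `A`. -/
def IsMorseSet (η : ℝ≥0 → ℝ≥0) (A : Set X) : Prop :=
  ∀ (lam : ℝ≥0), 1 ≤ lam → ∀ (L : ℝ) (γ : ℝ → X), 0 ≤ L →
    IsQuasiGeodesicOn lam γ (Icc 0 L) → γ 0 ∈ A → γ L ∈ A →
    ∀ t ∈ Icc 0 L, γ t ∈ Metric.cthickening (η lam) A

end Paths

section Actions

/-- Neither finite nor virtually cyclic (a finite group has the trivial cyclic subgroup as a
subgroup of finite index). -/
def NonElementary (G : Type*) [Group G] : Prop :=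
  ∀ g : G, ¬ (Subgroup.zpowers g).FiniteIndex

/-- A (metrically) proper action. On a proper metric space this is the same as: each compact set
meets only finitely many of its translates. -/
def ActsProperly (G X : Type*) [Group G] [MetricSpace X] [MulAction G X] : Prop :=
  ∀ (x : X) (r : ℝ), {g : G | dist x (g • x) ≤ r}.Finite

variable {G X : Type*} [Group G] [MetricSpace X] [MulAction G X]

/-- `g` is a contracting element: for some basepoint `o` and some choice of a geodesic `[o, g o]`,
the bi-infinite path obtained by concatenating the segments `gⁿ [o, g o]`, `n ∈ ℤ`, is a
quasi-geodesic whose image is a contracting subset. The path is parametrized by arc length on `ℝ`,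
with `gⁿ [o, g o]` as its restriction to `[n ℓ, (n + 1) ℓ]`, where `ℓ = d(o, g o)`. -/
def IsContractingElement (X : Type*) [MetricSpace X] [MulAction G X] (g : G) : Prop :=
  ∃ (o : X) (γ : ℝ → X),
    0 < dist o (g • o) ∧
    γ 0 = o ∧
    IsGeodesicOn γ (Icc 0 (dist o (g • o))) ∧
    (∀ t : ℝ, γ (t + dist o (g • o)) = g • γ t) ∧
    (∃ lam : ℝ≥0, 1 ≤ lam ∧ IsQuasiGeodesicOn lam γ univ) ∧
    ∃ C : ℝ, 0 < C ∧ IsContracting C (range γ)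

/-- `H` is a Morse subgroup: for a basepoint `o`, the orbit `H o` is `η`-Morse for some `η`. -/
def IsMorseSubgroup (X : Type*) [MetricSpace X] [MulAction G X] (H : Subgroup G) : Prop :=
  ∃ (o : X) (η : ℝ≥0 → ℝ≥0), IsMorseSet η (MulAction.orbit H o)

end Actions

section Horofunctions

variable {X : Type*} [MetricSpace X]

/-- The function `b_y : x ↦ d(x, y) - d(o, y)`, in the space `C(X, ℝ)` with its compact-open
topology. -/
def horoMap (o y : X) : C(X, ℝ) where
  toFun x := dist x y - dist o y
  continuous_toFun := by fun_prop

/-- The horofunction boundary: the complement of (the image of) `X` in its closure in `C(X, ℝ)`. -/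
def horoBoundary (o : X) : Set C(X, ℝ) :=
  closure (range (horoMap o)) \ range (horoMap o)

/-- The accumulation points in the horofunction boundary of a subset `A` of `X`. -/
def accPoints (o : X) (A : Set X) : Set C(X, ℝ) :=
  {ξ | ξ ∈ horoBoundary o ∧ AccPt ξ (𝓟 (horoMap o '' A))}

/-- Finite difference: `‖ξ - η‖_∞ ≤ K` for some `K`. -/
def FiniteDifference (ξ η : C(X, ℝ)) : Prop :=
  ∃ K : ℝ, ∀ x, |ξ x - η x| ≤ K

/-- The locus `[Λ]` of a subset of the horofunction boundary: the union of the finite difference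
classes, within the boundary, of its points. -/
def locus (o : X) (Λ : Set C(X, ℝ)) : Set C(X, ℝ) :=
  {η | η ∈ horoBoundary o ∧ ∃ ξ ∈ Λ, FiniteDifference ξ η}

/-- The limit set `[Λ H o]` of a subgroup `H`. -/
def limitSet {G : Type*} [Group G] [MulAction G X] (H : Subgroup G) (o : X) : Set C(X, ℝ) :=
  locus o (accPoints o (MulAction.orbit H o))

end Horofunctions

end CoarseGeom

/-! Suppose every limit point of `G` is a limit point of `H`. Translate the axis of a contracting
element by an arbitrary `h : G`. Each end of this line yields a horofunction in the limit set of
`G`, hence one at finite difference from an accumulation point of an `H`-orbit. Horofunctions at an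
end drop at unit speed along the line, so orbit points of `H` must project arbitrarily far towards
both ends (`exists_lt_of_mem_proj`). A geodesic joining two orbit points that project to opposite
sides of `h • o₁` passes near it (`exists_dist_le_of_straddle`), and the Morse property keeps that
geodesic near the `H`-orbit. The bounds do not depend on `h`, so the `G`-orbit is uniformly close to
the `H`-orbit, and properness makes the index finite (`finite_quotient_of_dist_orbit_le`). -/

namespace CoarseGeom

/-! ### Contracting lines: projections and coarse additivity of distance -/

section ContractingLines

variable {X : Type*} [MetricSpace X]

/-- A path `α : ℝ → X` that is `1`-Lipschitz, a quasi-isometric embedding with constant `lam`,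
and has a `C`-contracting image. -/
structure IsContractingLine (lam C : ℝ) (α : ℝ → X) : Prop where
  dist_le : ∀ s t, dist (α s) (α t) ≤ |s - t|
  le_dist : ∀ s t, |s - t| ≤ lam * dist (α s) (α t) + lam
  contracting : IsContracting C (range α)

theorem IsQuasiGeodesicOn.isContractingLine {lam : ℝ≥0} {C : ℝ} {γ : ℝ → X}
    (h : IsQuasiGeodesicOn lam γ univ) (hC : IsContracting C (range γ)) :
    IsContractingLine lam C γ := by
  have hlen : ∀ s t, s ≤ t → eVariationOn γ (Icc s t) = ENNReal.ofReal (t - s) := by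
    intro s t _
    have := h.1 (mem_univ s) (mem_univ t)
    simpa using this
  have h1 : ∀ s t, s ≤ t → dist (γ s) (γ t) ≤ t - s := by
    intro s t hst
    have := eVariationOn.edist_le γ (left_mem_Icc.2 hst) (right_mem_Icc.2 hst)
    rw [hlen s t hst, edist_dist] at this
    exact (ENNReal.ofReal_le_ofReal_iff (by linarith)).1 this
  have h2 : ∀ s t, s ≤ t → t - s ≤ lam * dist (γ s) (γ t) + lam := by
    intro s t hst
    have := h.2 s (mem_univ s) t (mem_univ t) hst
    rw [hlen s t hst] at this
    exact (ENNReal.ofReal_le_ofReal_iff (by positivity)).1 this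
  refine ⟨fun s t => ?_, fun s t => ?_, hC⟩
  · rcases le_total s t with hst | hst
    · rw [abs_sub_comm, abs_of_nonneg (by linarith)]; exact h1 s t hst
    · rw [dist_comm, abs_of_nonneg (by linarith)]; exact h1 t s hst
  · rcases le_total s t with hst | hst
    · rw [abs_sub_comm, abs_of_nonneg (by linarith)]; exact h2 s t hst
    · rw [dist_comm, abs_of_nonneg (by linarith)]; exact h2 t s hst

theorem IsGeodesicOn.mono {σ : ℝ → X} {I J : Set ℝ} (h : IsGeodesicOn σ I) (hJ : J ⊆ I) :
    IsGeodesicOn σ J :=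
  fun s hs t ht => h s (hJ hs) t (hJ ht)

theorem IsGeodesicOn.continuousOn {σ : ℝ → X} {I : Set ℝ} (h : IsGeodesicOn σ I) :
    ContinuousOn σ I :=
  (LipschitzOnWith.of_dist_le_mul (K := 1) fun s hs t ht => by
    rw [h s hs t ht, NNReal.coe_one, one_mul, Real.dist_eq]).continuousOn

theorem IsGeodesicOn.isQuasiGeodesicOn {σ : ℝ → X} {I : Set ℝ} (hI : I.OrdConnected)
    (h : IsGeodesicOn σ I) :
    IsQuasiGeodesicOn 1 σ I := by
  have hlen : ∀ s ∈ I, ∀ t ∈ I, s ≤ t →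
      eVariationOn σ (Icc s t) = ENNReal.ofReal (t - s) := by
    intro s hs t ht hst
    have hsub : Icc s t ⊆ I := hI.out hs ht
    have h1 : eVariationOn σ (Icc s t) = eVariationOn (fun x : ℝ => x) (Icc s t) := by
      unfold eVariationOn
      refine iSup_congr fun p => Finset.sum_congr rfl fun i _ => ?_
      rw [edist_dist, edist_dist, h _ (hsub (p.2.2.2 _)) _ (hsub (p.2.2.2 _)), Real.dist_eq]
    rw [h1]
    have := (monotone_id (α := ℝ)).monotoneOn (Icc s t) |>.eVariationOn_eq
      (left_mem_Icc.2 hst) (right_mem_Icc.2 hst)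
    rwa [inter_self] at this
  refine ⟨fun s hs t ht => ?_, fun s hs t ht hst => ?_⟩
  · rcases le_total s t with hst | hst
    · rw [inter_eq_right.2 (hI.out hs ht), hlen s hs t ht hst]; simp
    · rcases hst.eq_or_lt with rfl | hlt
      · simp [eVariationOn.subsingleton σ (s := I ∩ {t})
          (subsingleton_singleton.anti inter_subset_right)]
      · rw [Icc_eq_empty (by linarith), inter_empty, ENNReal.ofReal_of_nonpos]
        · simp
        · simpa using hlt.le
  · rw [hlen s hs t ht hst, h s hs t ht, abs_sub_comm, abs_of_nonneg (by linarith)]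
    refine ENNReal.ofReal_le_ofReal ?_
    simp

namespace IsContractingLine

variable {lam C : ℝ} {α : ℝ → X}

theorem lam_nonneg (h : IsContractingLine lam C α) : 0 ≤ lam := by
  have := h.le_dist 0 0
  simpa using this

theorem comp_neg (h : IsContractingLine lam C α) :
    IsContractingLine lam C (fun t => α (-t)) := by
  refine ⟨fun s t => ?_, fun s t => ?_, ?_⟩
  · have := h.dist_le (-s) (-t)
    rwa [show -s - -t = -(s - t) by ring, abs_neg] at this
  · have := h.le_dist (-s) (-t)
    rwa [show -s - -t = -(s - t) by ring, abs_neg] at this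
  · have : range (fun t => α (-t)) = range α := (Equiv.neg ℝ).surjective.range_comp α
    rw [this]; exact h.contracting

/-- Keeping the same `lam` and `C` for all translates is what makes the final bound uniform over
`G`. -/
theorem smul {G : Type*} [Group G] [MulAction G X] [IsIsometricSMul G X]
    (h : IsContractingLine lam C α) (g : G) : IsContractingLine lam C (fun t => g • α t) := by
  refine ⟨fun s t => ?_, fun s t => ?_, ?_⟩
  · simpa using h.dist_le s t
  · simpa using h.le_dist s t
  · have hd : ∀ x y : X, dist (g⁻¹ • x) y = dist x (g • y) := fun x y => by
      rw [← dist_smul g, smul_inv_smul]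
    have hproj : ∀ x p, p ∈ proj (range fun t => g • α t) x →
        g⁻¹ • p ∈ proj (range α) (g⁻¹ • x) := by
      rintro x _ ⟨⟨t, rfl⟩, hmin⟩
      refine ⟨⟨t, by simp⟩, ?_⟩
      rintro _ ⟨s, rfl⟩
      rw [dist_smul, hd]
      exact hmin _ ⟨s, rfl⟩
    intro σ I hI hσ hfar s hs t ht p hp q hq
    have := h.contracting (fun r => g⁻¹ • σ r) I hI (fun a ha b hb => by
      rw [dist_smul]; exact hσ a ha b hb) (by
      rintro a ha _ ⟨r, rfl⟩
      rw [hd]; exact hfar a ha _ ⟨r, rfl⟩) s hs t ht _ (hproj _ _ hp) _ (hproj _ _ hq)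
    rwa [dist_smul] at this

theorem continuous (h : IsContractingLine lam C α) : Continuous α :=
  (LipschitzWith.of_dist_le_mul (K := 1) fun s t => by
    simpa [Real.dist_eq] using h.dist_le s t).continuous

theorem isClosedMap [ProperSpace X] (h : IsContractingLine lam C α) : IsClosedMap α := by
  refine (isProperMap_iff_tendsto_cocompact.2 ⟨h.continuous, ?_⟩).isClosedMap
  refine tendsto_cocompact_of_tendsto_dist_comp_atTop (α 0) ?_
  have hl := h.lam_nonneg
  have h1 : Tendsto (fun t : ℝ => (lam + 1)⁻¹ * (|t| - lam)) (cocompact ℝ) atTop := by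
    refine Tendsto.const_mul_atTop (by positivity) ?_
    exact tendsto_atTop_add_const_right _ _ (tendsto_norm_cocompact_atTop (E := ℝ))
  refine tendsto_atTop_mono (fun t => ?_) h1
  have := h.le_dist t 0
  rw [sub_zero] at this
  rw [inv_mul_le_iff₀ (by positivity)]
  nlinarith [dist_nonneg (x := α t) (y := α 0)]

theorem exists_mem_proj [ProperSpace X] (h : IsContractingLine lam C α) (x : X) :
    ∃ s, α s ∈ proj (range α) x := by
  have hcl : IsClosed (range α) := by
    simpa using h.isClosedMap _ isClosed_univ
  obtain ⟨_, ⟨s, rfl⟩, hs⟩ := hcl.exists_infDist_eq_dist (range_nonempty α) x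
  exact ⟨s, ⟨s, rfl⟩, fun b hb => hs ▸ Metric.infDist_le_dist_of_mem hb⟩

theorem self_mem_proj (α : ℝ → X) (s : ℝ) : α s ∈ proj (range α) (α s) :=
  ⟨⟨s, rfl⟩, fun b _ => by simp⟩

/-- The geodesic must come `C`-close to the line, or contraction would force `dist p q ≤ C`. Up to
the first such time its projection has moved by at most `C`, whence `2 * C`. -/
theorem exists_dist_le_of_lt_dist [ProperSpace X] (h : IsContractingLine lam C α) (hC : 0 ≤ C) {σ : ℝ → X}
    {a b : ℝ} (hab : a ≤ b) (hσ : IsGeodesicOn σ (Icc a b)) {p q : X}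
    (hp : p ∈ proj (range α) (σ a)) (hq : q ∈ proj (range α) (σ b)) (hpq : C < dist p q) :
    ∃ u ∈ Icc a b, dist (σ u) p ≤ 2 * C := by
  set A := range α
  have hAne : A.Nonempty := range_nonempty α
  have hfar : ∀ J : Set ℝ, J ⊆ Icc a b → J.OrdConnected →
      (∀ t ∈ J, C ≤ Metric.infDist (σ t) A) →
      ∀ s ∈ J, ∀ t ∈ J, ∀ p ∈ proj A (σ s), ∀ q ∈ proj A (σ t), dist p q ≤ C := by
    intro J hJ hJc hJf
    exact h.contracting σ J hJc (hσ.mono hJ) fun t ht x hx =>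
      (hJf t ht).trans (Metric.infDist_le_dist_of_mem hx)
  set S := {t | t ∈ Icc a b ∧ Metric.infDist (σ t) A ≤ C}
  have hcont : ContinuousOn (fun t => Metric.infDist (σ t) A) (Icc a b) :=
    (Metric.continuous_infDist_pt A).comp_continuousOn hσ.continuousOn
  have hS : IsCompact S := by
    have : IsClosed S := hcont.preimage_isClosed_of_isClosed isClosed_Icc isClosed_Iic
    exact isCompact_Icc.of_isClosed_subset this fun t ht => ht.1
  have hSne : S.Nonempty := by
    by_contra hne
    refine absurd (hfar (Icc a b) le_rfl ordConnected_Icc (fun t ht => ?_) a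
      (left_mem_Icc.2 hab) b (right_mem_Icc.2 hab) p hp q hq) (not_le.2 hpq)
    by_contra hlt
    exact hne ⟨t, ht, (not_le.1 hlt).le⟩
  obtain ⟨u, ⟨hu, huC⟩, hmin⟩ := hS.exists_isLeast hSne
  refine ⟨u, hu, ?_⟩
  rcases hu.1.eq_or_lt with rfl | hau
  · have : dist (σ a) p ≤ Metric.infDist (σ a) A :=
      (Metric.le_infDist hAne).2 fun {x} hx => hp.2 x hx
    linarith
  have hge : ∀ t ∈ Icc a u, C ≤ Metric.infDist (σ t) A := by
    have h1 : ∀ t ∈ Ico a u, C ≤ Metric.infDist (σ t) A := fun t ht => by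
      by_contra hlt
      exact absurd (hmin ⟨⟨ht.1, ht.2.le.trans hu.2⟩, (not_le.1 hlt).le⟩) (not_le.2 ht.2)
    intro t ht
    rw [← closure_Ico hau.ne] at ht
    refine le_on_closure h1 continuousOn_const ?_ ht
    rw [closure_Ico hau.ne]
    exact hcont.mono (Icc_subset_Icc_right hu.2)
  obtain ⟨r, hr⟩ := h.exists_mem_proj (σ u)
  have h1 : dist (σ u) (α r) ≤ Metric.infDist (σ u) A :=
    (Metric.le_infDist hAne).2 fun {x} hx => hr.2 x hx
  have h2 := hfar (Icc a u) (Icc_subset_Icc_right hu.2) ordConnected_Icc hge a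
    (left_mem_Icc.2 hu.1) u (right_mem_Icc.2 hu.1) p hp _ hr
  linarith [dist_triangle_right (σ u) p (α r)]

theorem dist_le_of_mem_proj (h : IsContractingLine lam C α) (hC : 0 ≤ C) {x p q : X}
    (hp : p ∈ proj (range α) x) (hq : q ∈ proj (range α) x) : dist p q ≤ 2 * C := by
  by_cases hx : ∀ a ∈ range α, C ≤ dist x a
  · have := h.contracting (fun _ => x) {0} ordConnected_singleton
      (by rintro _ rfl _ rfl; simp) (fun _ _ => hx) 0 rfl 0 rfl p hp q hq
    linarith
  · push Not at hx
    obtain ⟨a, ha, hax⟩ := hx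
    linarith [dist_triangle_left p q x, hp.2 a ha, hq.2 a ha]

/-- By the intermediate value theorem some `σ t` is equidistant from the two halves of the line cut
at `T`, so it has projections `α r₁`, `α r₂` on both sides. These are `2 * C`-close, hence `r₂` is
near `T`; the margin on `s₂` then separates `α r₂` from `α s₂` by more than `C`, and the previous
entry estimate applies on `[t, b]`. -/
theorem exists_dist_le_of_straddle [ProperSpace X] (h : IsContractingLine lam C α) (hC : 0 ≤ C)
    {σ : ℝ → X} {a b : ℝ} (hab : a ≤ b) (hσ : IsGeodesicOn σ (Icc a b)) {s₁ s₂ T : ℝ}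
    (h₁ : α s₁ ∈ proj (range α) (σ a)) (h₂ : α s₂ ∈ proj (range α) (σ b))
    (hs₁ : s₁ ≤ T) (hs₂ : T + (3 * (lam * C) + 2 * lam) < s₂) :
    ∃ u ∈ Icc a b, dist (σ u) (α T) ≤ 2 * C + 2 * (lam * C) + lam := by
  have hl := h.lam_nonneg
  have hlC : 0 ≤ lam * C := mul_nonneg hl hC
  set A₁ := α '' Iic T
  set A₂ := α '' Ici T
  have hA₁ : IsClosed A₁ := h.isClosedMap _ isClosed_Iic
  have hA₂ : IsClosed A₂ := h.isClosedMap _ isClosed_Ici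
  have hn₁ : A₁.Nonempty := nonempty_Iic.image α
  have hn₂ : A₂.Nonempty := nonempty_Ici.image α
  have hcont : ContinuousOn (fun t => Metric.infDist (σ t) A₁ - Metric.infDist (σ t) A₂)
      (Icc a b) :=
    ((Metric.continuous_infDist_pt A₁).comp_continuousOn hσ.continuousOn).sub
      ((Metric.continuous_infDist_pt A₂).comp_continuousOn hσ.continuousOn)
  obtain ⟨t, ht, h0⟩ := intermediate_value_Icc hab hcont (show (0 : ℝ) ∈ Icc _ _ by
    constructor
    · rw [sub_nonpos, Metric.le_infDist hn₂]
      rintro _ ⟨s, -, rfl⟩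
      exact (Metric.infDist_le_dist_of_mem (mem_image_of_mem α (mem_Iic.2 hs₁))).trans (h₁.2 _ ⟨s, rfl⟩)
    · rw [sub_nonneg, Metric.le_infDist hn₁]
      rintro _ ⟨s, -, rfl⟩
      refine (Metric.infDist_le_dist_of_mem (mem_image_of_mem α ?_)).trans (h₂.2 _ ⟨s, rfl⟩)
      rw [mem_Ici]; linarith)
  obtain ⟨_, ⟨r₁, hr₁, rfl⟩, e₁⟩ := hA₁.exists_infDist_eq_dist hn₁ (σ t)
  obtain ⟨_, ⟨r₂, hr₂, rfl⟩, e₂⟩ := hA₂.exists_infDist_eq_dist hn₂ (σ t)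
  have he : Metric.infDist (σ t) A₁ = Metric.infDist (σ t) A₂ := sub_eq_zero.1 h0
  rw [mem_Iic] at hr₁
  rw [mem_Ici] at hr₂
  have hmin : ∀ x ∈ range α, Metric.infDist (σ t) A₁ ≤ dist (σ t) x := by
    rintro _ ⟨s, rfl⟩
    rcases le_total s T with hs | hs
    · exact Metric.infDist_le_dist_of_mem (mem_image_of_mem α hs)
    · rw [he]; exact Metric.infDist_le_dist_of_mem (mem_image_of_mem α hs)
  have hp₁ : α r₁ ∈ proj (range α) (σ t) := ⟨⟨r₁, rfl⟩, fun x hx => e₁ ▸ hmin x hx⟩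
  have hp₂ : α r₂ ∈ proj (range α) (σ t) := ⟨⟨r₂, rfl⟩, fun x hx => e₂ ▸ he ▸ hmin x hx⟩
  have hd : |r₁ - r₂| ≤ 2 * (lam * C) + lam := by
    have := mul_le_mul_of_nonneg_left (h.dist_le_of_mem_proj hC hp₁ hp₂) hl
    linarith [h.le_dist r₁ r₂]
  rw [abs_sub_comm, abs_of_nonneg (by linarith)] at hd
  have hlt : C < dist (α r₂) (α s₂) := by
    by_contra hle
    have := mul_le_mul_of_nonneg_left (not_lt.1 hle) hl
    have h3 := h.le_dist r₂ s₂
    rw [abs_sub_comm] at h3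
    linarith [le_abs_self (s₂ - r₂)]
  obtain ⟨u, hu, hur⟩ := h.exists_dist_le_of_lt_dist hC ht.2
    (hσ.mono (Icc_subset_Icc_left ht.1)) hp₂ h₂ hlt
  refine ⟨u, ⟨ht.1.trans hu.1, hu.2⟩, ?_⟩
  have h4 := h.dist_le r₂ T
  rw [abs_of_nonneg (by linarith)] at h4
  linarith [dist_triangle (σ u) (α r₂) (α T)]

/-- The distance to points of a contracting line is coarsely additive beyond the projection. -/
theorem dist_add_dist_le [ProperSpace X] (hX : IsGeodesicSpace X) (h : IsContractingLine lam C α)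
    (hC : 0 ≤ C) {x : X} {s T t : ℝ} (hs : α s ∈ proj (range α) x) (hsT : s ≤ T) (hTt : T ≤ t) :
    dist x (α T) + dist (α T) (α t) ≤ dist x (α t) + (4 * C + 10 * (lam * C) + 6 * lam) := by
  have hl := h.lam_nonneg
  have hlC : 0 ≤ lam * C := mul_nonneg hl hC
  -- The error term adds up both cases: twice the straddling bound, and twice the margin when `t` is
  -- close to `T`.
  rcases lt_or_ge (T + (3 * (lam * C) + 2 * lam)) t with hlt | hge
  · obtain ⟨σ, h0, h1, hσ⟩ := hX x (α t)
    obtain ⟨u, hu, hd⟩ := h.exists_dist_le_of_straddle hC dist_nonneg hσ (by rwa [h0])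
      (by rw [h1]; exact self_mem_proj α t) hsT hlt
    have e1 := hσ 0 (left_mem_Icc.2 dist_nonneg) u hu
    have e2 := hσ u hu _ (right_mem_Icc.2 dist_nonneg)
    rw [h0, abs_sub_comm, sub_zero, abs_of_nonneg hu.1] at e1
    rw [h1, abs_sub_comm, abs_of_nonneg (by linarith [hu.2])] at e2
    linarith [dist_triangle x (σ u) (α T), dist_triangle (α T) (σ u) (α t),
      dist_comm (σ u) (α T)]
  · have := h.dist_le T t
    rw [abs_sub_comm, abs_of_nonneg (by linarith)] at this
    linarith [dist_triangle x (α t) (α T), dist_comm (α T) (α t)]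

/-- A horofunction approximated by points near the positive end of a contracting line decreases
along the line at unit speed, up to bounded error. -/
theorem horofunction_sub_le [ProperSpace X] (hX : IsGeodesicSpace X)
    (h : IsContractingLine lam C α) (hC : 0 ≤ C) {o : X} {ξ : C(X, ℝ)} {D : ℝ}
    (hξ : ∀ N : ℝ, ∀ a b : X, ∃ y, ∃ r ≥ N, dist y (α r) ≤ D ∧
      |horoMap o y a - ξ a| ≤ 1 ∧ |horoMap o y b - ξ b| ≤ 1) {T t : ℝ} (hTt : T ≤ t) :
    ξ (α t) - ξ (α T) ≤
      -dist (α T) (α t) + (4 * C + 10 * (lam * C) + 6 * lam) + 2 * D + 2 := by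
  obtain ⟨y, r, hr, hy, h1, h2⟩ := hξ t (α t) (α T)
  rw [abs_le] at h1 h2
  simp only [horoMap, ContinuousMap.coe_mk] at h1 h2
  linarith [dist_triangle (α t) (α r) y, dist_triangle (α T) y (α r), dist_comm y (α r),
    h.dist_add_dist_le hX hC (self_mem_proj α T) hTt hr]

theorem exists_le_dist (h : IsContractingLine lam C α) (T R : ℝ) :
    ∃ t ≥ T, R ≤ dist (α T) (α t) := by
  have hl := h.lam_nonneg
  refine ⟨T + ((lam + 1) * |R| + lam), ?_, ?_⟩
  · have : 0 ≤ (lam + 1) * |R| + lam := by positivity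
    linarith
  · have := h.le_dist T (T + ((lam + 1) * |R| + lam))
    rw [sub_add_cancel_left, abs_neg, abs_of_nonneg (by positivity)] at this
    refine (le_abs_self R).trans ?_
    by_contra hlt
    rw [not_le] at hlt
    nlinarith [dist_nonneg (x := α T) (y := α (T + ((lam + 1) * |R| + lam))), abs_nonneg R]

/-- If a horofunction at the positive end of a contracting line is at finite difference from an
accumulation point of `B`, then points of `B` project arbitrarily far along the line. -/
theorem exists_lt_of_mem_proj [ProperSpace X] (hX : IsGeodesicSpace X)
    (h : IsContractingLine lam C α) (hC : 0 ≤ C) {o : X} {ξ ζ : C(X, ℝ)} {D : ℝ}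
    (hξ : ∀ N : ℝ, ∀ a b : X, ∃ y, ∃ r ≥ N, dist y (α r) ≤ D ∧
      |horoMap o y a - ξ a| ≤ 1 ∧ |horoMap o y b - ξ b| ≤ 1)
    {B : Set X} {E : ℝ}
    (hζ : ∀ a b : X, ∃ y ∈ B, |horoMap o y a - ζ a| ≤ E ∧ |horoMap o y b - ζ b| ≤ E)
    (hfin : FiniteDifference ζ ξ) (T : ℝ) :
    ∃ z ∈ B, ∀ s, α s ∈ proj (range α) z → T < s := by
  obtain ⟨K, hK⟩ := hfin
  -- If `z` projected before `T`, then `horoMap o z` would rise from `α T` to `α t` by nearly their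
  -- distance, while `ξ` falls by nearly as much. This distance exceeds what the errors allow.
  obtain ⟨t, hTt, ht⟩ := h.exists_le_dist T (4 * C + 10 * (lam * C) + 6 * lam + D + K + E + 2)
  obtain ⟨z, hz, h1, h2⟩ := hζ (α t) (α T)
  refine ⟨z, hz, fun s hs => ?_⟩
  by_contra hsT
  have h3 := h.dist_add_dist_le hX hC hs (not_lt.1 hsT) hTt
  have h4 := h.horofunction_sub_le hX hC hξ hTt
  have h5 := hK (α t)
  have h6 := hK (α T)
  rw [abs_le] at h1 h2 h5 h6
  simp only [horoMap, ContinuousMap.coe_mk] at h1 h2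
  linarith [dist_comm (α t) z, dist_comm (α T) z]

end IsContractingLine

end ContractingLines

/-! ### Compactness and accumulation points in the horofunction boundary -/

section Horofunctions

variable {X : Type*} [MetricSpace X]

theorem horoMap_lipschitz (o y : X) : LipschitzWith 1 (horoMap o y) :=
  LipschitzWith.of_le_add fun a b => by
    simp only [horoMap, ContinuousMap.coe_mk]
    linarith [dist_triangle a b y]

/-- The space of normalized `1`-Lipschitz functions is compact in the compact-open topology. -/
theorem isCompact_setOf_lipschitzWith_one (o : X) :
    IsCompact {f : C(X, ℝ) | LipschitzWith 1 f ∧ f o = 0} := by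
  refine ArzelaAscoli.isCompact_of_equicontinuous _ ?_ ?_
  · have himage : ContinuousMap.toFun '' {f : C(X, ℝ) | LipschitzWith 1 f ∧ f o = 0} =
        {f : X → ℝ | LipschitzWith 1 f ∧ f o = 0} := by
      ext f
      constructor
      · rintro ⟨g, hg, rfl⟩; exact hg
      · intro hf; exact ⟨⟨f, hf.1.continuous⟩, hf, rfl⟩
    rw [himage]
    refine (isCompact_univ_pi fun x =>
      isCompact_Icc (a := -dist x o) (b := dist x o)).of_isClosed_subset
        ?_ ?_
    · have : {f : X → ℝ | LipschitzWith 1 f ∧ f o = 0} =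
          (⋂ (x : X) (y : X), {f : X → ℝ | dist (f x) (f y) ≤ dist x y}) ∩ {f | f o = 0} := by
        ext f
        simp [lipschitzWith_iff_dist_le_mul]
      rw [this]
      refine IsClosed.inter (isClosed_iInter fun x => isClosed_iInter fun y => ?_) ?_
      · exact isClosed_le (by fun_prop) continuous_const
      · exact isClosed_eq (by fun_prop) continuous_const
    · rintro f ⟨hf, h0⟩ x -
      have := hf.dist_le_mul x o
      rw [h0, Real.dist_eq, sub_zero, NNReal.coe_one, one_mul] at this
      exact abs_le.1 this
  · exact (LipschitzWith.uniformEquicontinuous _ 1 fun f => f.2.1).equicontinuous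

theorem exists_mapClusterPt_horoMap (o : X) (y : ℕ → X) :
    ∃ ξ : C(X, ℝ), MapClusterPt ξ atTop fun n => horoMap o (y n) := by
  obtain ⟨ξ, -, hξ⟩ := (isCompact_setOf_lipschitzWith_one o).exists_mapClusterPt_of_frequently
    (l := atTop) (f := fun n => horoMap o (y n))
    (Eventually.frequently (Eventually.of_forall fun n =>
      ⟨horoMap_lipschitz o _, by simp [horoMap]⟩))
  exact ⟨ξ, hξ⟩

/-- Only the variation of a horofunction between two points, up to bounded error, is ever used. -/
theorem setOf_abs_sub_le_mem_nhds (ξ : C(X, ℝ)) (a b : X) :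
    {f : C(X, ℝ) | |f a - ξ a| ≤ 1 ∧ |f b - ξ b| ≤ 1} ∈ 𝓝 ξ := by
  have h : ∀ c : X, ∀ᶠ f in 𝓝 ξ, |f c - ξ c| ≤ 1 := fun c => by
    have := (continuous_eval_const (F := C(X, ℝ)) c).tendsto ξ
    filter_upwards [this (Metric.closedBall_mem_nhds _ one_pos)] with f hf
    simpa [Real.dist_eq] using hf
  exact (h a).and (h b)

theorem exists_horoMap_near_of_mem_accPoints {o : X} {A : Set X} {ζ : C(X, ℝ)}
    (hζ : ζ ∈ accPoints o A) (a b : X) :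
    ∃ y ∈ A, |horoMap o y a - ζ a| ≤ 1 ∧ |horoMap o y b - ζ b| ≤ 1 := by
  obtain ⟨f, ⟨hf, y, hy, rfl⟩, -⟩ := accPt_iff_nhds.1 hζ.2 _ (setOf_abs_sub_le_mem_nhds ζ a b)
  exact ⟨y, hy, hf⟩

/-- A sequence going to the positive end of a contracting line, up to bounded distance,
accumulates in the horofunction boundary. -/
theorem IsContractingLine.exists_mem_accPoints [ProperSpace X] (hX : IsGeodesicSpace X)
    {lam C : ℝ} {α : ℝ → X} (h : IsContractingLine lam C α) (hC : 0 ≤ C) (o : X) {A : Set X}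
    {y : ℕ → X} (hyA : ∀ n, y n ∈ A) {r : ℕ → ℝ} (hr : Tendsto r atTop atTop) {D : ℝ}
    (hD : ∀ n, dist (y n) (α (r n)) ≤ D) :
    ∃ ξ ∈ accPoints o A, ∀ N : ℝ, ∀ a b : X, ∃ y, ∃ r ≥ N, dist y (α r) ≤ D ∧
      |horoMap o y a - ξ a| ≤ 1 ∧ |horoMap o y b - ξ b| ≤ 1 := by
  obtain ⟨ξ, hξ⟩ := exists_mapClusterPt_horoMap o y
  have hnear : ∀ N : ℝ, ∀ a b : X, ∃ y, ∃ r ≥ N, dist y (α r) ≤ D ∧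
      |horoMap o y a - ξ a| ≤ 1 ∧ |horoMap o y b - ξ b| ≤ 1 := by
    intro N a b
    obtain ⟨n, hn, hN⟩ := ((hξ.frequently (setOf_abs_sub_le_mem_nhds ξ a b)).and_eventually
      (hr.eventually_ge_atTop N)).exists
    exact ⟨y n, r n, hN, hD n, hn⟩
  -- Each `horoMap o x` is bounded below, whereas `ξ` tends to `-∞` along the line.
  have hnr : ξ ∉ range (horoMap o) := by
    rintro ⟨x, rfl⟩
    obtain ⟨t, ht, hR⟩ := h.exists_le_dist 0 (4 * C + 10 * (lam * C) + 6 * lam + 2 * D + 2 +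
      dist (α 0) x + 1)
    have := h.horofunction_sub_le hX hC hnear ht
    simp only [horoMap, ContinuousMap.coe_mk] at this
    linarith [dist_nonneg (x := α t) (y := x)]
  refine ⟨ξ, ⟨⟨?_, hnr⟩, ?_⟩, hnear⟩
  · rw [mem_closure_iff_nhds]
    intro U hU
    obtain ⟨n, hn⟩ := (hξ.frequently hU).exists
    exact ⟨_, hn, y n, rfl⟩
  · rw [accPt_iff_nhds]
    intro U hU
    obtain ⟨n, hn⟩ := (hξ.frequently hU).exists
    exact ⟨_, ⟨hn, y n, hyA n, rfl⟩, fun he => hnr ⟨y n, he⟩⟩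

theorem locus_mono (o : X) {A B : Set X} (hAB : A ⊆ B) :
    locus o (accPoints o A) ⊆ locus o (accPoints o B) := by
  rintro η ⟨hη, ξ, ⟨hξ, hacc⟩, hfin⟩
  exact ⟨hη, ξ, ⟨hξ, hacc.mono (principal_mono.2 (image_mono hAB))⟩, hfin⟩

theorem subset_locus (o : X) (A : Set X) : accPoints o A ⊆ locus o (accPoints o A) :=
  fun ξ hξ => ⟨hξ.1, ξ, hξ, 0, fun x => by simp⟩

end Horofunctions

/-! ### Orbits, limit sets and finite index -/

theorem apply_mul_eq_pow_smul {G X : Type*} [Group G] [MulAction G X] {g : G} {γ : ℝ → X} {l : ℝ} (h : ∀ t, γ (t + l) = g • γ t) (n : ℕ) :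
    γ (n * l) = g ^ n • γ 0 := by
  induction n with
  | zero => simp
  | succ n ih => rw [Nat.cast_succ, add_one_mul, h, ih, smul_smul, pow_succ']

section Actions

variable {G X : Type*} [Group G] [MetricSpace X] [MulAction G X]

/-- A subgroup whose orbit comes within bounded distance of every point of a `G`-orbit has finite
index. -/
theorem finite_quotient_of_dist_orbit_le [IsIsometricSMul G X] (hproper : ActsProperly G X)
    (H : Subgroup G) (x : X) (R : ℝ) (hR : ∀ g : G, ∃ k ∈ H, dist (g • x) (k • x) ≤ R) :
    Finite (G ⧸ H) := by
  have := (hproper x R).to_subtype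
  refine Finite.of_surjective
    (fun f : {g : G | dist x (g • x) ≤ R} => (QuotientGroup.mk (f : G)⁻¹ : G ⧸ H)) fun q => ?_
  obtain ⟨g, rfl⟩ := QuotientGroup.mk_surjective q
  -- Inverses because the cosets are left cosets: `k⁻¹ * g⁻¹` moves `x` by at most `R`, and its
  -- inverse `g * k` lies in `gH`.
  obtain ⟨k, hk, hd⟩ := hR g⁻¹
  refine ⟨⟨k⁻¹ * g⁻¹, ?_⟩, ?_⟩
  · rwa [mem_ofPred_eq, mul_smul, dist_comm, ← dist_smul k, smul_inv_smul]
  · rw [QuotientGroup.eq]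
    simpa using H.inv_mem hk

/-- Moving `y` by a distance `d` changes `horoMap o y` by at most `2 * d`. This reconciles the
basepoint of the limit set with that of the Morse property. -/
theorem exists_orbit_near_of_mem_accPoints [IsIsometricSMul G X] {H : Subgroup G} {o : X}
    {ζ : C(X, ℝ)} (hζ : ζ ∈ accPoints o (MulAction.orbit H o)) (o' a b : X) :
    ∃ y ∈ MulAction.orbit H o', |horoMap o y a - ζ a| ≤ 1 + 2 * dist o o' ∧
      |horoMap o y b - ζ b| ≤ 1 + 2 * dist o o' := by
  obtain ⟨_, ⟨k, rfl⟩, ha, hb⟩ := exists_horoMap_near_of_mem_accPoints hζ a b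
  have hk : dist (k • o) (k • o') = dist o o' :=
    dist_smul (k : G) o o'
  have key : ∀ c, |horoMap o (k • o) c - ζ c| ≤ 1 →
      |horoMap o (k • o') c - ζ c| ≤ 1 + 2 * dist o o' := by
    intro c hc
    rw [abs_le] at hc ⊢
    simp only [horoMap, ContinuousMap.coe_mk] at hc ⊢
    have h1 := dist_triangle c (k • o) (k • o')
    have h2 := dist_triangle_right c (k • o) (k • o')
    have h3 := dist_triangle o (k • o) (k • o')
    have h4 := dist_triangle_right o (k • o) (k • o')
    constructor <;> linarith
  exact ⟨k • o', ⟨k, rfl⟩, key a ha, key b hb⟩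

/-- If the limit set of `H` is everything, then `H`-orbits have points projecting far along a
contracting line whose positive end is a limit of a `G`-orbit. -/
theorem IsContractingLine.exists_orbit_projection [ProperSpace X] [IsIsometricSMul G X]
    (hX : IsGeodesicSpace X) {lam C : ℝ} {α : ℝ → X} (h : IsContractingLine lam C α) (hC : 0 ≤ C)
    {H : Subgroup G} {o : X} (hH : limitSet (⊤ : Subgroup G) o ⊆ limitSet H o) {o₁ : X} (f : ℕ → G)
    {l : ℝ} (hl : 0 < l) (hf : ∀ n : ℕ, α (n * l) = f n • o₁) (o₂ : X) (T : ℝ) :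
    ∃ z ∈ MulAction.orbit H o₂, ∀ s, α s ∈ proj (range α) z → T < s := by
  obtain ⟨ξ, hξ, hnear⟩ := h.exists_mem_accPoints hX hC o
    (A := MulAction.orbit (⊤ : Subgroup G) o) (y := fun n => f n • o) (D := dist o o₁)
    (fun n => ⟨⟨f n, Subgroup.mem_top _⟩, rfl⟩)
    (tendsto_natCast_atTop_atTop.atTop_mul_const hl) (fun n => by rw [hf, dist_smul])
  obtain ⟨-, ζ, hζ, hfin⟩ := hH (subset_locus o _ hξ)
  exact h.exists_lt_of_mem_proj hX hC hnear (exists_orbit_near_of_mem_accPoints hζ o₂) hfin T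

/-- If the limit set of a Morse subgroup `H` is everything, then `H` has finite index. -/
theorem finite_quotient_of_limitSet_subset [ProperSpace X] [IsIsometricSMul G X]
    (hX : IsGeodesicSpace X) (hproper : ActsProperly G X) {g : G} (hg : IsContractingElement X g)
    {H : Subgroup G} (hMorse : IsMorseSubgroup X H) {o : X}
    (hH : limitSet (⊤ : Subgroup G) o ⊆ limitSet H o) : Finite (G ⧸ H) := by
  obtain ⟨o₁, γ, hl, hγ0, -, hper, ⟨lam, -, hqg⟩, C, hC, hcontr⟩ := hg
  obtain ⟨o₂, η, hη⟩ := hMorse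
  set l := dist o₁ (g • o₁)
  have hline := hqg.isContractingLine hcontr
  -- The reversed axis is an axis of `g⁻¹`, so the negative end is handled as a positive one.
  have hneg : ∀ t, γ (-(t + l)) = g⁻¹ • γ (-t) := fun t => by
    rw [eq_inv_smul_iff, ← hper]; congr 1; ring
  set K : ℝ := 2 * C + 2 * (lam * C) + lam
  refine finite_quotient_of_dist_orbit_le hproper H o₁ (K + (η 1 + 1) + dist o₁ o₂) fun h => ?_
  have hα := hline.smul h
  set α : ℝ → X := fun t => h • γ t
  obtain ⟨z₂, hz₂, hs₂⟩ := hα.exists_orbit_projection hX hC.le hH (o₁ := o₁)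
    (fun n => h * g ^ n) hl (fun n => by
      simp only [α]
      rw [apply_mul_eq_pow_smul hper, hγ0, mul_smul]) o₂ (0 + (3 * (lam * C) + 2 * lam))
  obtain ⟨z₁, hz₁, hs₁⟩ := hα.comp_neg.exists_orbit_projection hX hC.le hH (o₁ := o₁)
    (fun n => h * g⁻¹ ^ n) hl (fun n => by
      simp only [α]
      rw [apply_mul_eq_pow_smul (γ := fun t => γ (-t)) hneg, neg_zero, hγ0, mul_smul]) o₂ 0
  obtain ⟨s₁, hp₁⟩ := hα.exists_mem_proj z₁
  obtain ⟨s₂, hp₂⟩ := hα.exists_mem_proj z₂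
  have hs₁' : s₁ ≤ 0 := by
    have hrange : range (fun t => α (-t)) = range α := (Equiv.neg ℝ).surjective.range_comp α
    have := hs₁ (-s₁) (by rwa [hrange, neg_neg])
    linarith
  obtain ⟨σ, hσ0, hσ1, hσ⟩ := hX z₁ z₂
  obtain ⟨u, hu, hd⟩ := hα.exists_dist_le_of_straddle hC.le dist_nonneg hσ
    (by rwa [hσ0]) (by rwa [hσ1]) hs₁' (hs₂ s₂ hp₂)
  have hmorse := hη 1 le_rfl _ σ dist_nonneg (hσ.isQuasiGeodesicOn ordConnected_Icc)
    (by rwa [hσ0]) (by rwa [hσ1]) u hu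
  -- The extra `1` passes to an open thickening, where a nearby orbit point exists.
  obtain ⟨_, ⟨k, rfl⟩, hk⟩ := Metric.mem_thickening_iff.1
    (Metric.cthickening_subset_thickening' (δ₂ := η 1 + 1) (by positivity) (by simp) _ hmorse)
  refine ⟨k, k.2, ?_⟩
  have hk' : dist ((k : G) • o₁) ((k : G) • o₂) = dist o₁ o₂ := dist_smul _ _ _
  have hα0 : α 0 = h • o₁ := by simp only [α, hγ0]
  rw [hα0] at hd
  change dist (σ u) ((k : G) • o₂) < _ at hk
  linarith [dist_triangle_left (h • o₁) ((k : G) • o₁) (σ u),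
    dist_triangle_right (σ u) ((k : G) • o₁) ((k : G) • o₂)]

end Actions

end CoarseGeom

theorem corollary2p20 {G X : Type*} [Group G] [MetricSpace X] [ProperSpace X]
    [MulAction G X] [IsIsometricSMul G X]
    (hX : CoarseGeom.IsGeodesicSpace X)
    (hproper : CoarseGeom.ActsProperly G X)
    (hne : CoarseGeom.NonElementary G)
    (hcontr : ∃ g : G, CoarseGeom.IsContractingElement X g)
    (H : Subgroup G)
    (hMorse : CoarseGeom.IsMorseSubgroup X H)
    (hindex : Infinite (G ⧸ H))
    (o : X) :
    CoarseGeom.limitSet H o ⊂ CoarseGeom.limitSet (⊤ : Subgroup G) o := by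
  obtain ⟨g, hg⟩ := hcontr
  refine ⟨CoarseGeom.locus_mono o ?_, fun hsub => ?_⟩
  · rintro _ ⟨k, rfl⟩
    exact ⟨⟨k, Subgroup.mem_top _⟩, rfl⟩
  · exact not_finite_iff_infinite.2 hindex
      (CoarseGeom.finite_quotient_of_limitSet_subset hX hproper hg hMorse hsub)
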